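/- Let $V=\mathbb R^2$ with coordinates $(p,q)$ and symplectic form $\omega=dp\wedge dq$, with Poisson bracket $\{u,v\}=\partial_pu\,\partial_qv-\partial_qu\,\partial_pv$. Let $H=\begin{pmatrix}1&0\\0&-1\end{pmatrix}$, $E=\begin{pmatrix}0&1\\0&0\end{pmatrix}$, let $h_1=\mathrm{span}_{\mathbb R}\{H,E\}$, and let $S=\exp(\mathbb RH)\exp(\mathbb RE)\subset SL(2,\mathbb R)$ be the "$ax+b$" group, acting linearly on $V$. The map $g\mapsto g\cdot(0,1)$ identifies $S$ with the orbit $\mathcal O=\{q>0\}\subset V$. Each $A\in h_1$ acts on the algebra $C^\infty(\mathcal O)$ of smooth complex-valued functions by its left-invariant vector field, $(\tilde A u)(g\cdot(0,1))=\frac{d}{dt}\big|_{0}u(g\exp(tA)\cdot(0,1))$, and so $U(h_1)$ acts on $C^\infty(\mathcal O)$. Put $X=E$ and $Y=\frac12H$, so that $[Y,X]=X$, write $(\alpha)_m=\alpha(\alpha+1)\cdots(\alpha+m-1)$, and let $$RC_n(u,v)=\sum_{k=0}^n\frac{(-1)^k}{k!}\,X^k(2Y+k)_{n-k}(u)\cdot\frac1{(n-k)!}\,X^{n-k}(2Y+n-k)_k(v),\qquad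 u,v\in C^\infty(\mathcal O).$$ For $c\in\mathbb C$ let $\star^{RC}_c$ be the reduced Rankin–Cohen deformation on $C^\infty(\mathcal O)[[\hbar]]$, that is, the $\hbar$-adically continuous $\mathbb C[[\hbar]]$-bilinear product with $u\star^{RC}_c v=\sum_{n\ge0}(c\hbar)^nRC_n(u,v)$ for $u,v\in C^\infty(\mathcal O)$. For $U\subset V$ open let $\star^M_c$ be the Moyal product on $C^\infty(U)[[\hbar]]$, that is, the product of the same kind with $$u\star^M_c v=\sum_{n\ge0}\frac{(c\hbar)^n}{n!}\,m\big((\partial_p\otimes\partial_q-\partial_q\otimes\partial_p)^n(u\otimes v)\big),\qquad u,v\in C^\infty(U),$$ where $m$ is pointwise multiplication. Then, for every $c\in\mathbb C$ (that is, for every normalization of the deformation parameter), the reduced Rankin–Cohen deformation realized on $\mathcal O$ coincides with the restriction to $\mathcal O$ of the standard Moyal product on $(V,\omega)$: one has $a\star^{RC}_c b=a\star^M_c b$ for all $a,b\in C^\infty(\mathcal O)[[\hbar]]$, and $f|_{\mathcal O}\star^{RC}_c g|_{\mathcal O}=(f\star^M_c g)|_{\mathcal O}$ for all $f,g\in C^\infty(V)[[\hbar]]$.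 -/

import Mathlib

open scoped ContDiff TensorProduct Nat
open TopologicalSpace

namespace RankinCohen

noncomputable section

/-! ### Smooth functions on open subsets of the plane -/

/-- The plane with coordinates `p = x 0`, `q = x 1`. -/
abbrev Plane : Type := Fin 2 → ℝ

open Classical in
/-- Extension by zero of a function on an open set to the whole plane; only its germs at points of
the open set are ever used. -/
def zeroExt (U : Opens Plane) (u : U → ℂ) : Plane → ℂ :=
  fun x => if h : x ∈ U then u ⟨x, h⟩ else 0

lemma zeroExt_of_mem {U : Opens Plane} (u : U → ℂ) {x : Plane} (h : x ∈ U) :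
    zeroExt U u x = u ⟨x, h⟩ := by
  simp [zeroExt, h]

lemma zeroExt_add (U : Opens Plane) (u v : U → ℂ) :
    zeroExt U (u + v) = zeroExt U u + zeroExt U v := by
  funext x
  by_cases h : x ∈ U <;> simp [zeroExt, h]

lemma zeroExt_mul (U : Opens Plane) (u v : U → ℂ) :
    zeroExt U (u * v) = zeroExt U u * zeroExt U v := by
  funext x
  by_cases h : x ∈ U <;> simp [zeroExt, h]

lemma zeroExt_smul (U : Opens Plane) (c : ℂ) (u : U → ℂ) :
    zeroExt U (c • u) = c • zeroExt U u := by
  funext x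
  by_cases h : x ∈ U <;> simp [zeroExt, h]

/-- A function on `U` obtained by restriction from the plane agrees with its extension on `U`. -/
lemma zeroExt_restrict (U : Opens Plane) (f : Plane → ℂ) :
    Set.EqOn (zeroExt U (fun x => f x)) f U := fun _ hx => zeroExt_of_mem _ hx

/-- The algebra `C^∞(U)` of smooth complex-valued functions on the open set `U`. -/
def smoothFun (U : Opens Plane) : Subalgebra ℂ (U → ℂ) where
  carrier := {u | ContDiffOn ℝ ∞ (zeroExt U u) U}
  mul_mem' {u v} hu hv := by
    simp only [Set.mem_ofPred_eq, zeroExt_mul] at *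
    exact hu.mul hv
  add_mem' {u v} hu hv := by
    simp only [Set.mem_ofPred_eq, zeroExt_add] at *
    exact hu.add hv
  algebraMap_mem' c := by
    exact (contDiffOn_const (c := c)).congr (zeroExt_restrict U fun _ => c)

lemma smoothFun_of_eqOn {U : Opens Plane} {u : U → ℂ} {f : Plane → ℂ}
    (hf : ContDiffOn ℝ ∞ f U) (h : ∀ x : U, u x = f x) : u ∈ smoothFun U :=
  ContDiffOn.congr (f₁ := zeroExt U u) hf fun x hx => by rw [zeroExt_of_mem u hx]; exact h ⟨x, hx⟩

lemma smoothFun_contDiffAt {U : Opens Plane} (u : smoothFun U) (x : U) :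
    ContDiffAt ℝ ∞ (zeroExt U u) x :=
  u.2.contDiffAt (U.isOpen.mem_nhds x.2)

lemma smoothFun_differentiableAt {U : Opens Plane} (u : smoothFun U) (x : U) :
    DifferentiableAt ℝ (zeroExt U u) x :=
  (smoothFun_contDiffAt u x).differentiableAt (by simp)

/-- The partial derivatives `∂_p = pderiv U 0` and `∂_q = pderiv U 1` on `C^∞(U)`. -/
def pderiv (U : Opens Plane) (i : Fin 2) : smoothFun U →ₗ[ℂ] smoothFun U where
  toFun u := ⟨fun x => fderiv ℝ (zeroExt U u) x (Pi.single i 1),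
    smoothFun_of_eqOn (f := fun x => fderiv ℝ (zeroExt U u) x (Pi.single i 1))
      ((u.2.fderiv_of_isOpen U.isOpen (by simp)).clm_apply contDiffOn_const) fun _ => rfl⟩
  map_add' u v := by
    ext x
    simp [zeroExt_add, fderiv_add (smoothFun_differentiableAt u x) (smoothFun_differentiableAt v x)]
  map_smul' c u := by
    ext x
    simp [zeroExt_smul, fderiv_const_smul (smoothFun_differentiableAt u x)]

/-- The restriction map `C^∞(ℝ²) → C^∞(U)`. -/
def restrict (U : Opens Plane) : smoothFun ⊤ →+* smoothFun U where
  toFun f := ⟨fun x => f.1 ⟨x, trivial⟩,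
    smoothFun_of_eqOn (f := zeroExt ⊤ f) (f.2.mono fun _ _ => trivial)
      fun x => (zeroExt_of_mem f.1 (U := ⊤) (x := x) trivial).symm⟩
  map_one' := rfl
  map_mul' _ _ := rfl
  map_zero' := rfl
  map_add' _ _ := rfl

/-! ### Products on formal power series and the Moyal product -/

/-- The product on `A[[ħ]]` (`ħ` is the variable of the power series) defined by a sequence
of bilinear operations `C n` on `A`:
`(∑ ħ^i a_i) ⋆ (∑ ħ^j b_j) = ∑_N ħ^N ∑_{n + i + j = N} C n (a_i, b_j)`. -/
def formalProduct {A : Type*} [CommRing A] (C : ℕ → A → A → A) (a b : PowerSeries A) :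
    PowerSeries A :=
  PowerSeries.mk fun N =>
    ∑ x ∈ Finset.HasAntidiagonal.antidiagonal N, ∑ y ∈ Finset.HasAntidiagonal.antidiagonal x.2,
      C x.1 (PowerSeries.coeff y.1 a) (PowerSeries.coeff y.2 b)

/-- For operators `D₁, D₂` on an algebra `A`, the operator `D₁ ⊗ D₂ - D₂ ⊗ D₁` on `A ⊗ A`. -/
def wedgeOperator {A : Type*} [CommRing A] [Algebra ℂ A] (D₁ D₂ : A →ₗ[ℂ] A) :
    Module.End ℂ (A ⊗[ℂ] A) :=
  TensorProduct.map D₁ D₂ - TensorProduct.map D₂ D₁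

/-- The coefficient of order `n` of the Moyal product of the symplectic form `dp ∧ dq`: the
bidifferential operator `(u, v) ↦ (1 / n!) · m ((∂_p ⊗ ∂_q - ∂_q ⊗ ∂_p)^n (u ⊗ v))`, with `m` the
pointwise product. -/
def moyalCochain (U : Opens Plane) (n : ℕ) (u v : smoothFun U) : smoothFun U :=
  ((n ! : ℂ)⁻¹) • LinearMap.mul' ℂ (smoothFun U)
    ((wedgeOperator (pderiv U 0) (pderiv U 1) ^ n) (u ⊗ₜ[ℂ] v))

/-- The Moyal product `m ∘ exp (c ħ (∂_p ⊗ ∂_q - ∂_q ⊗ ∂_p))` on `C^∞(U)[[ħ]]`. The complex number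
`c` is the normalization of the deformation parameter. -/
def moyalProduct (U : Opens Plane) (c : ℂ) (a b : PowerSeries (smoothFun U)) :
    PowerSeries (smoothFun U) :=
  formalProduct (fun n u v => c ^ n • moyalCochain U n u v) a b

/-! ### The Lie algebra and the group of type `ax + b` -/

/-- The element `H` of `sl₂(ℝ)`. -/
def matH : Matrix (Fin 2) (Fin 2) ℝ := !![1, 0; 0, -1]

/-- The element `E` of `sl₂(ℝ)`. -/
def matE : Matrix (Fin 2) (Fin 2) ℝ := !![0, 1; 0, 0]

attribute [local instance] LieRing.ofAssociativeRing

/-- The Lie algebra `h₁ = span {H, E}`, where `[H, E] = 2 E`. -/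
def h1 : LieSubalgebra ℝ (Matrix (Fin 2) (Fin 2) ℝ) :=
  { Submodule.span ℝ {matH, matE} with
    lie_mem' := by
      intro A B hA hB
      obtain ⟨a, b, rfl⟩ := Submodule.mem_span_pair.1 hA
      obtain ⟨c, d, rfl⟩ := Submodule.mem_span_pair.1 hB
      refine Submodule.mem_span_pair.2 ⟨0, 2 * (a * d - b * c), ?_⟩
      ext i j
      fin_cases i <;> fin_cases j <;>
        simp [Ring.lie_def, matH, matE] <;> ring }

lemma mem_h1 {A : Matrix (Fin 2) (Fin 2) ℝ} : A ∈ h1 ↔ ∃ a b : ℝ, a • matH + b • matE = A :=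
  Submodule.mem_span_pair

/-- The generator `X = E` of `h₁`. -/
def genX : h1 := ⟨matE, mem_h1.2 ⟨0, 1, by simp⟩⟩

/-- The generator `Y = H / 2` of `h₁`. -/
def genY : h1 := ⟨(1 / 2 : ℝ) • matH, mem_h1.2 ⟨1 / 2, 0, by simp⟩⟩

lemma genY_lie_genX : ⁅genY, genX⁆ = genX := by
  apply Subtype.ext
  rw [LieSubalgebra.coe_bracket]
  ext i j
  fin_cases i <;> fin_cases j <;>
    (simp [genX, genY, Ring.lie_def, matH, matE]; try norm_num)

/-- The `ax + b` group `S = AN = exp (ℝ H) exp (ℝ E)`: the upper triangular matrices in `SL(2, ℝ)`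
with positive diagonal. -/
def axb : Subgroup (Matrix.SpecialLinearGroup (Fin 2) ℝ) where
  carrier := {g | g 1 0 = 0 ∧ 0 < g 0 0}
  one_mem' := by simp
  mul_mem' {g h} hg hh := by
    simp only [Set.mem_ofPred_eq, Matrix.SpecialLinearGroup.coe_mul, Matrix.mul_apply,
      Fin.sum_univ_two] at *
    exact ⟨by simp [hg.1, hh.1], by rw [hh.1]; simpa using mul_pos hg.2 hh.2⟩
  inv_mem' {g} hg := by
    have hdet : g 0 0 * g 1 1 = 1 := by
      have := g.det_coe
      rw [Matrix.det_fin_two, hg.1] at this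
      simpa using this
    simp only [Set.mem_ofPred_eq, Matrix.SpecialLinearGroup.SL2_inv_expl] at *
    refine ⟨by simp [hg.1], ?_⟩
    simpa using (pos_iff_pos_of_mul_pos (by rw [hdet]; exact one_pos)).1 hg.2

/-- The base point `(p, q) = (0, 1)`. -/
def basePoint : Plane := ![0, 1]

/-- The open half plane `q > 0`. -/
def halfPlane : Opens Plane where
  carrier := {x | 0 < x 1}
  is_open' := isOpen_lt continuous_const (continuous_apply 1)

/-- The identification `S ≃ 𝒪`, `g ↦ g · (0, 1)`, of the group with the orbit of the base point,
which is the half plane `q > 0`. -/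
def orbitEquiv : axb ≃ halfPlane where
  toFun g := ⟨(g : Matrix (Fin 2) (Fin 2) ℝ).mulVec basePoint, by
    have hdet : g.1 0 0 * g.1 1 1 = 1 := by
      have := g.1.det_coe
      rw [Matrix.det_fin_two, g.2.1] at this
      simpa using this
    have h := (pos_iff_pos_of_mul_pos (by rw [hdet]; exact one_pos)).1 g.2.2
    change 0 < (g.1 : Matrix (Fin 2) (Fin 2) ℝ).mulVec basePoint 1
    simpa [basePoint, Matrix.mulVec, dotProduct, Fin.sum_univ_two] using h⟩
  invFun x := ⟨⟨!![(x.1 1)⁻¹, x.1 0; 0, x.1 1], by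
      have : x.1 1 ≠ 0 := ne_of_gt x.2
      simp [Matrix.det_fin_two, this]⟩, by
      have : 0 < x.1 1 := x.2
      change _ ∧ _
      simpa using this⟩
  left_inv g := by
    have hdet : g.1 0 0 * g.1 1 1 = 1 := by
      have := g.1.det_coe
      rw [Matrix.det_fin_two, g.2.1] at this
      simpa using this
    have h10 : g.1 1 0 = 0 := g.2.1
    have hinv : (g.1 1 1)⁻¹ = g.1 0 0 := inv_eq_of_mul_eq_one_left hdet
    apply Subtype.ext
    apply Matrix.SpecialLinearGroup.ext
    intro i j
    fin_cases i <;> fin_cases j <;>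
      simp [basePoint, Matrix.mulVec, dotProduct, Fin.sum_univ_two, h10, hinv]
  right_inv x := by
    apply Subtype.ext
    funext i
    fin_cases i <;> simp [basePoint, Matrix.mulVec, dotProduct, Fin.sum_univ_two]

/-! ### Left-invariant vector fields -/

open scoped Matrix.Norms.Operator in
lemma hasSum_exp_entry (A : Matrix (Fin 2) (Fin 2) ℝ) (i j : Fin 2) :
    HasSum (fun n : ℕ => (n ! : ℝ)⁻¹ * (A ^ n) i j) (NormedSpace.exp A i j) := by
  have h := NormedSpace.exp_series_hasSum_exp' (𝕂 := ℝ) A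
  have h2 := (Pi.hasSum.1 (Pi.hasSum.1 h i)) j
  simp only [Matrix.smul_apply, smul_eq_mul] at h2
  exact h2

lemma h1_entries {A : Matrix (Fin 2) (Fin 2) ℝ} (hA : A ∈ h1) : A 1 0 = 0 ∧ A 1 1 = -A 0 0 := by
  obtain ⟨a, b, rfl⟩ := mem_h1.1 hA
  simp [matH, matE]

lemma pow_entries {A : Matrix (Fin 2) (Fin 2) ℝ} (hA : A 1 0 = 0) (n : ℕ) :
    (A ^ n) 1 0 = 0 ∧ (A ^ n) 0 0 = A 0 0 ^ n ∧ (A ^ n) 1 1 = A 1 1 ^ n := by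
  induction n with
  | zero => simp
  | succ n ih =>
    obtain ⟨h1, h2, h3⟩ := ih
    simp [pow_succ, Matrix.mul_apply, Fin.sum_univ_two, h1, h2, h3, hA]

lemma exp_entries {A : Matrix (Fin 2) (Fin 2) ℝ} (hA : A 1 0 = 0) :
    NormedSpace.exp A 1 0 = 0 ∧ NormedSpace.exp A 0 0 = Real.exp (A 0 0) ∧
      NormedSpace.exp A 1 1 = Real.exp (A 1 1) := by
  have key (x : ℝ) : HasSum (fun n : ℕ => (n ! : ℝ)⁻¹ * x ^ n) (Real.exp x) := by
    rw [Real.exp_eq_exp_ℝ]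
    simpa using NormedSpace.exp_series_hasSum_exp' (𝕂 := ℝ) x
  refine ⟨(hasSum_exp_entry A 1 0).unique ?_, (hasSum_exp_entry A 0 0).unique ?_,
    (hasSum_exp_entry A 1 1).unique ?_⟩
  · simp [pow_entries hA, hasSum_zero]
  · simpa [pow_entries hA] using key (A 0 0)
  · simpa [pow_entries hA] using key (A 1 1)

/-- The exponential map `h₁ → S`, given by the matrix exponential. -/
def expS (A : h1) : axb :=
  ⟨⟨NormedSpace.exp (A : Matrix (Fin 2) (Fin 2) ℝ), by
      obtain ⟨h10, h11⟩ := h1_entries A.2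
      obtain ⟨e10, e00, e11⟩ := exp_entries h10
      rw [Matrix.det_fin_two, e10, e00, e11, h11, ← Real.exp_add]
      simp⟩, by
    obtain ⟨h10, -⟩ := h1_entries A.2
    obtain ⟨e10, e00, -⟩ := exp_entries h10
    change _ = _ ∧ 0 < NormedSpace.exp (A : Matrix (Fin 2) (Fin 2) ℝ) 0 0
    exact ⟨e10, e00 ▸ Real.exp_pos _⟩⟩

/-- The derivative of `u : 𝒪 → ℂ` along the left-invariant vector field of `A ∈ h₁`: at the point
`g · (0, 1)` it is `d/dt|_{t = 0} u (g exp (t A) · (0, 1))`. -/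
def leftInvariantDeriv (A : h1) (u : halfPlane → ℂ) (x : halfPlane) : ℂ :=
  deriv (fun t : ℝ => u (orbitEquiv (orbitEquiv.symm x * expS (t • A)))) 0

open scoped Matrix.Norms.Operator in
lemma hasDerivAt_exp_entry (A : Matrix (Fin 2) (Fin 2) ℝ) (i j : Fin 2) :
    HasDerivAt (fun t : ℝ => NormedSpace.exp (t • A) i j) (A i j) 0 := by
  have h := hasDerivAt_exp_smul_const (𝕂 := ℝ) A (0 : ℝ)
  have h2 := hasDerivAt_pi.1 (hasDerivAt_pi.1 h i) j
  simp only [zero_smul, NormedSpace.exp_zero, one_mul] at h2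
  exact h2

/-- The left-invariant vector field of `A` in the coordinates `(p, q)`. -/
lemma leftInvariantDeriv_eq (A : h1) (u : smoothFun halfPlane) (x : halfPlane) :
    leftInvariantDeriv A u x =
      ((x.1 0 * A.1 1 1 + (x.1 1)⁻¹ * A.1 0 1 : ℝ) : ℂ) * (pderiv halfPlane 0 u).1 x +
        ((x.1 1 * A.1 1 1 : ℝ) : ℂ) * (pderiv halfPlane 1 u).1 x := by
  have hq : x.1 1 ≠ 0 := ne_of_gt x.2
  set γ : ℝ → Plane := fun t => (orbitEquiv (orbitEquiv.symm x * expS (t • A))).1 with hγdef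
  have hγ (t : ℝ) (i : Fin 2) : γ t i =
      (orbitEquiv.symm x).1 i 0 * NormedSpace.exp (t • A.1) 0 1 +
        (orbitEquiv.symm x).1 i 1 * NormedSpace.exp (t • A.1) 1 1 := by
    change ((orbitEquiv.symm x * expS (t • A) : axb).1 : Matrix (Fin 2) (Fin 2) ℝ).mulVec
      basePoint i = _
    simp only [Subgroup.coe_mul, Matrix.SpecialLinearGroup.coe_mul]
    simp [expS, basePoint, Matrix.mulVec, dotProduct, Fin.sum_univ_two, Matrix.mul_apply]
  have hx0 : γ 0 = x.1 := by
    have h0 : expS ((0 : ℝ) • A) = 1 := by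
      apply Subtype.ext
      apply Subtype.ext
      simp [expS]
    simp only [hγdef, h0, mul_one, Equiv.apply_symm_apply]
  have hγ' : HasDerivAt γ (fun i => (orbitEquiv.symm x).1 i 0 * A.1 0 1 +
      (orbitEquiv.symm x).1 i 1 * A.1 1 1) 0 := by
    rw [hasDerivAt_pi]
    intro i
    simp only [hγ]
    exact ((hasDerivAt_exp_entry A.1 0 1).const_mul _).add
      ((hasDerivAt_exp_entry A.1 1 1).const_mul _)
  have hu : HasFDerivAt (zeroExt halfPlane u) (fderiv ℝ (zeroExt halfPlane u) x.1) (γ 0) := by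
    rw [hx0]
    exact (smoothFun_differentiableAt u x).hasFDerivAt
  have hcomp := hu.comp_hasDerivAt (0 : ℝ) hγ'
  have hfun : (fun t : ℝ => u.1 (orbitEquiv (orbitEquiv.symm x * expS (t • A)))) =
      zeroExt halfPlane u ∘ γ := by
    funext t
    exact (zeroExt_of_mem u.1 (orbitEquiv (orbitEquiv.symm x * expS (t • A))).2).symm
  have hv : (fun i => (orbitEquiv.symm x).1 i 0 * A.1 0 1 + (orbitEquiv.symm x).1 i 1 * A.1 1 1) =
      (x.1 0 * A.1 1 1 + (x.1 1)⁻¹ * A.1 0 1) • (Pi.single 0 1 : Plane) +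
        (x.1 1 * A.1 1 1) • (Pi.single 1 1 : Plane) := by
    funext i
    fin_cases i
    · simp [orbitEquiv]
      ring
    · simp [orbitEquiv]
  rw [leftInvariantDeriv, hfun, hcomp.deriv, hv, map_add, map_smul, map_smul]
  simp [pderiv]

lemma pderiv_mul (U : Opens Plane) (i : Fin 2) (u v : smoothFun U) :
    pderiv U i (u * v) = u * pderiv U i v + v * pderiv U i u := by
  ext x
  have h := fderiv_mul (smoothFun_differentiableAt u x) (smoothFun_differentiableAt v x)
  have h2 := congrArg (fun L => L (Pi.single i 1 : Plane)) h
  simpa [pderiv, zeroExt_mul, zeroExt_of_mem] using h2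

lemma pderiv_comm (U : Opens Plane) (i j : Fin 2) (u : smoothFun U) :
    pderiv U i (pderiv U j u) = pderiv U j (pderiv U i u) := by
  have key (i j : Fin 2) (x : U) : (pderiv U i (pderiv U j u)).1 x =
      fderiv ℝ (fderiv ℝ (zeroExt U u)) x (Pi.single i 1) (Pi.single j 1) := by
    have he : zeroExt U (pderiv U j u) =ᶠ[nhds x.1]
        fun y => fderiv ℝ (zeroExt U u) y (Pi.single j 1) :=
      Filter.eventuallyEq_of_mem (U.isOpen.mem_nhds x.2) fun y hy => zeroExt_of_mem _ hy
    have hd : DifferentiableAt ℝ (fderiv ℝ (zeroExt U u)) x.1 :=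
      ((smoothFun_contDiffAt u x).fderiv_right (m := 1) (by norm_cast)).differentiableAt
        (by simp)
    change fderiv ℝ (zeroExt U (pderiv U j u)) x.1 (Pi.single i 1) = _
    rw [he.fderiv_eq, fderiv_clm_apply hd (by fun_prop)]
    simp
  ext x
  rw [key, key]
  exact ((smoothFun_contDiffAt u x).isSymmSndFDerivAt (by simp; norm_cast)).eq _ _

/-- A real function on the plane that is smooth on `𝒪`, as an element of `C^∞(𝒪)`. -/
def ofPlane (f : Plane → ℝ) (hf : ContDiffOn ℝ ∞ f halfPlane) : smoothFun halfPlane :=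
  ⟨fun x => (f x : ℂ), smoothFun_of_eqOn (f := fun x => (f x : ℂ))
    (Complex.ofRealCLM.contDiff.comp_contDiffOn hf) fun _ => rfl⟩

lemma pderiv_ofPlane (i : Fin 2) {f : Plane → ℝ} (hf : ContDiffOn ℝ ∞ f halfPlane)
    (x : halfPlane) :
    (pderiv halfPlane i (ofPlane f hf)).1 x = ((fderiv ℝ f x (Pi.single i 1) : ℝ) : ℂ) := by
  have he : zeroExt halfPlane (ofPlane f hf) =ᶠ[nhds x.1] fun y => (f y : ℂ) :=
    Filter.eventuallyEq_of_mem (halfPlane.isOpen.mem_nhds x.2) fun y hy => zeroExt_of_mem _ hy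
  have hd : DifferentiableAt ℝ f x.1 :=
    (hf.contDiffAt (halfPlane.isOpen.mem_nhds x.2)).differentiableAt (by simp)
  change fderiv ℝ (zeroExt halfPlane (ofPlane f hf)) x.1 (Pi.single i 1) = _
  rw [he.fderiv_eq]
  have h := (Complex.ofRealCLM.hasFDerivAt (x := f x.1)).comp x.1 hd.hasFDerivAt
  exact congrArg (fun L => L (Pi.single i 1 : Plane)) h.fderiv

lemma contDiffOn_coeff (a b : ℝ) :
    ContDiffOn ℝ ∞ (fun x : Plane => x 0 * a + (x 1)⁻¹ * b) halfPlane := by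
  have h0 : ContDiff ℝ ∞ fun x : Plane => x 0 := contDiff_apply ℝ ℝ 0
  have h1 : ContDiff ℝ ∞ fun x : Plane => x 1 := contDiff_apply ℝ ℝ 1
  exact (h0.contDiffOn.mul contDiffOn_const).add
    ((h1.contDiffOn.inv fun x hx => ne_of_gt hx).mul contDiffOn_const)

lemma contDiffOn_coeff' (a : ℝ) : ContDiffOn ℝ ∞ (fun x : Plane => x 1 * a) halfPlane :=
  (contDiff_apply ℝ ℝ 1).contDiffOn.mul contDiffOn_const

lemma pderiv_coeff (a b : ℝ) (x : halfPlane) :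
    (pderiv halfPlane 0 (ofPlane _ (contDiffOn_coeff a b))).1 x = a ∧
    (pderiv halfPlane 1 (ofPlane _ (contDiffOn_coeff a b))).1 x = -((x.1 1 : ℂ) ^ 2)⁻¹ * b := by
  have hq : x.1 1 ≠ 0 := ne_of_gt x.2
  have h0 : HasFDerivAt (fun y : Plane => y 0) (ContinuousLinearMap.proj 0 : Plane →L[ℝ] ℝ) x.1 :=
    hasFDerivAt_apply 0 x.1
  have h1 : HasFDerivAt (fun y : Plane => y 1) (ContinuousLinearMap.proj 1 : Plane →L[ℝ] ℝ) x.1 :=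
    hasFDerivAt_apply 1 x.1
  have h := (h0.mul_const a).add (((hasDerivAt_inv hq).comp_hasFDerivAt x.1 h1).mul_const b)
  have h' : fderiv ℝ (fun y : Plane => y 0 * a + (y 1)⁻¹ * b) x.1 = _ := h.fderiv
  constructor
  · rw [pderiv_ofPlane, h']
    simp
  · rw [pderiv_ofPlane, h']
    simp [mul_comm]

lemma pderiv_coeff' (a : ℝ) (x : halfPlane) :
    (pderiv halfPlane 0 (ofPlane _ (contDiffOn_coeff' a))).1 x = 0 ∧
    (pderiv halfPlane 1 (ofPlane _ (contDiffOn_coeff' a))).1 x = a := by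
  have h1 : HasFDerivAt (fun y : Plane => y 1) (ContinuousLinearMap.proj 1 : Plane →L[ℝ] ℝ) x.1 :=
    hasFDerivAt_apply 1 x.1
  have h' : fderiv ℝ (fun y : Plane => y 1 * a) x.1 = _ := (h1.mul_const a).fderiv
  constructor
  · rw [pderiv_ofPlane, h']
    simp
  · rw [pderiv_ofPlane, h']
    simp

lemma leftInvariantDeriv_eq_mul (A : h1) (u : smoothFun halfPlane) :
    leftInvariantDeriv A u =
      (ofPlane _ (contDiffOn_coeff (A.1 1 1) (A.1 0 1)) * pderiv halfPlane 0 u +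
        ofPlane _ (contDiffOn_coeff' (A.1 1 1)) * pderiv halfPlane 1 u : smoothFun halfPlane) := by
  funext x
  exact leftInvariantDeriv_eq A u x

/-- The action of `A ∈ h₁` on `C^∞(𝒪)` by its left-invariant vector field. -/
def leftInvariantField (A : h1) : Module.End ℝ (smoothFun halfPlane) where
  toFun u := ⟨leftInvariantDeriv A u, by
    rw [leftInvariantDeriv_eq_mul]
    exact Subtype.prop _⟩
  map_add' u v := by
    apply Subtype.ext
    funext x
    simp only [leftInvariantDeriv_eq_mul, map_add]
    simp
    ring
  map_smul' c u := by
    apply Subtype.ext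
    funext x
    have (i : Fin 2) : pderiv halfPlane i (c • u) = c • pderiv halfPlane i u :=
      (pderiv halfPlane i).map_smul_of_tower c u
    simp only [leftInvariantDeriv_eq_mul, this]
    simp

lemma leftInvariantField_apply (A : h1) (u : smoothFun halfPlane) :
    leftInvariantField A u =
      ofPlane _ (contDiffOn_coeff (A.1 1 1) (A.1 0 1)) * pderiv halfPlane 0 u +
        ofPlane _ (contDiffOn_coeff' (A.1 1 1)) * pderiv halfPlane 1 u :=
  Subtype.ext (leftInvariantDeriv_eq_mul A u)

/-- The representation of `h₁` on `C^∞(𝒪)` by left-invariant vector fields. -/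
def leftInvariantAction : h1 →ₗ⁅ℝ⁆ Module.End ℝ (smoothFun halfPlane) where
  toFun := leftInvariantField
  map_add' A B := by
    ext u x
    simp [leftInvariantField_apply, ofPlane]
    ring
  map_smul' c A := by
    ext u x
    simp [leftInvariantField_apply, ofPlane]
    ring
  map_lie' {A B} := by
    have hA := h1_entries A.2
    have hB := h1_entries B.2
    ext u x
    have hq : (x.1 1 : ℂ) ≠ 0 := by exact_mod_cast ne_of_gt x.2
    have c1 := pderiv_coeff (A.1 1 1) (A.1 0 1) x
    have c2 := pderiv_coeff' (A.1 1 1) x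
    have c3 := pderiv_coeff (B.1 1 1) (B.1 0 1) x
    have c4 := pderiv_coeff' (B.1 1 1) x
    have e1 : (⁅A, B⁆ : h1).1 1 1 = 0 := by
      rw [LieSubalgebra.coe_bracket, Ring.lie_def]
      simp [Matrix.mul_apply, Fin.sum_univ_two, hA.1, hB.1, mul_comm]
    have e2 : (⁅A, B⁆ : h1).1 0 1 = 2 * (A.1 0 1 * B.1 1 1 - A.1 1 1 * B.1 0 1) := by
      rw [LieSubalgebra.coe_bracket, Ring.lie_def]
      simp [Matrix.mul_apply, Fin.sum_univ_two, hA.2, hB.2]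
      ring
    rw [Ring.lie_def]
    simp only [LinearMap.sub_apply, Module.End.mul_apply, leftInvariantField_apply, map_add,
      pderiv_mul, pderiv_comm halfPlane 1 0, Subalgebra.coe_add, Subalgebra.coe_mul,
      Subalgebra.coe_sub, Pi.add_apply, Pi.mul_apply, Pi.sub_apply, c1, c2, c3, c4, e1, e2]
    simp [ofPlane]
    field_simp
    ring

/-! ### The reduced Rankin–Cohen deformation -/

/-- The universal enveloping algebra `U(h₁)`. -/
abbrev Uh1 : Type := UniversalEnvelopingAlgebra ℝ h1

/-- `X` as an element of `U(h₁)`. -/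
def uX : Uh1 := UniversalEnvelopingAlgebra.ι ℝ genX

/-- `Y` as an element of `U(h₁)`. -/
def uY : Uh1 := UniversalEnvelopingAlgebra.ι ℝ genY

/-- The rising factorial `(α)_m = α (α + 1) ⋯ (α + m - 1)` in `U(h₁)`. -/
def rising (α : Uh1) (m : ℕ) : Uh1 := Polynomial.aeval α (ascPochhammer ℝ m)

/-- The Rankin–Cohen element
`RC_n = ∑_{k = 0}^n (-1)^k / k! · X^k (2Y + k)_{n - k} ⊗ 1 / (n - k)! · X^{n - k} (2Y + n - k)_k`
of `U(h₁) ⊗ U(h₁)`. -/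
def rcElement (n : ℕ) : Uh1 ⊗[ℝ] Uh1 :=
  ∑ k ∈ Finset.range (n + 1),
    (((-1 : ℝ) ^ k / (k ! : ℝ)) • (uX ^ k * rising (2 * uY + (k : Uh1)) (n - k))) ⊗ₜ[ℝ]
      ((1 / ((n - k) ! : ℝ)) • (uX ^ (n - k) * rising (2 * uY + ((n - k : ℕ) : Uh1)) k))

/-- For a left action of `U(h₁)` on a commutative algebra `A`, the operation on `A` defined by an
element of `U(h₁) ⊗ U(h₁)`: the element `x ⊗ y` acts by `(a, b) ↦ (x a) (y b)`. -/
def bidiffAction {A : Type*} [CommRing A] [Algebra ℝ A] (ρ : Uh1 →ₐ[ℝ] Module.End ℝ A)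
    (t : Uh1 ⊗[ℝ] Uh1) (a b : A) : A :=
  LinearMap.mul' ℝ A (TensorProduct.map (ρ.toLinearMap.flip a) (ρ.toLinearMap.flip b) t)

/-- The Rankin–Cohen brackets on `C^∞(𝒪)`, defined by the action of `U(h₁)` by left-invariant
differential operators. -/
def rcBracket (n : ℕ) (u v : smoothFun halfPlane) : smoothFun halfPlane :=
  bidiffAction (UniversalEnvelopingAlgebra.lift ℝ leftInvariantAction) (rcElement n) u v

/-- The reduced Rankin–Cohen deformation `∑_n (c ħ)^n RC_n` realized on `C^∞(𝒪)[[ħ]]`. The complex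
number `c` is the normalization of the deformation parameter. -/
def rcProduct (c : ℂ) (a b : PowerSeries (smoothFun halfPlane)) :
    PowerSeries (smoothFun halfPlane) :=
  formalProduct (fun n u v => c ^ n • rcBracket n u v) a b

end

end RankinCohen

open scoped ContDiff TensorProduct Nat
open TopologicalSpace

namespace RankinCohen

noncomputable section

/-! ### The fields `X` and `2 Y` in coordinates -/

/-! In coordinates `X` is `q⁻¹ ∂_p` and `2Y` is minus the Euler field `p ∂_p + q ∂_q`. Fix a point
`x = (p, q)` and let `T = p ∂_p + q ∂_q` with `p`, `q` frozen at their values at `x`, so that `T`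
has constant coefficients and commutes with `∂_p`.

Each constant coefficient field `D` satisfies `D (2Y) = (2Y - 1) D`, and at `x` itself `2Y` is `-T`.
Moving derivatives across `2Y` therefore uses up exactly the shifts in the rising factorials, and at
`x` the operator `X^k (2Y + k)_m` becomes `q^{-k} (-1)^m T^m ∂_p^k`
(`envAction_uX_pow_mul_rising_apply`).

On the Moyal side `∂_p ∧ ∂_p = 0` gives `q (∂_p ∧ ∂_q) = ∂_p ∧ T`. Its two tensor terms commute, so
the binomial theorem expands the `n`-th power (`wedgeOperator_pow_tmul`). The two sums then agree
term by term at `x`, which is `rcBracket_eq_moyalCochain`. The statement on restrictions follows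
because differential operators are local. -/

lemma leftInvariantField_genX_apply (u : smoothFun halfPlane) (x : halfPlane) :
    (leftInvariantField genX u).1 x = ((x.1 1 : ℝ) : ℂ)⁻¹ * (pderiv halfPlane 0 u).1 x := by
  rw [leftInvariantField_apply]
  simp [ofPlane, genX, matE]

lemma two_leftInvariantField_genY_apply (u : smoothFun halfPlane) (x : halfPlane) :
    2 * (leftInvariantField genY u).1 x =
      -((x.1 0 : ℂ) * (pderiv halfPlane 0 u).1 x + (x.1 1 : ℂ) * (pderiv halfPlane 1 u).1 x) := by
  rw [leftInvariantField_apply]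
  simp [ofPlane, genY, matH]
  ring

/-- The coefficient `q⁻¹` of `X` does not depend on `p`; this fails for `∂_q`. -/
lemma pderiv_leftInvariantField_genX (u : smoothFun halfPlane) :
    pderiv halfPlane 0 (leftInvariantField genX u) =
      leftInvariantField genX (pderiv halfPlane 0 u) := by
  ext x
  have h := pderiv_coeff (genX.1 1 1) (genX.1 0 1) x
  have h' := pderiv_coeff' (genX.1 1 1) x
  simp only [leftInvariantField_apply, map_add, pderiv_mul, pderiv_comm halfPlane 1 0,
    Subalgebra.coe_add, Subalgebra.coe_mul, Pi.add_apply, Pi.mul_apply, h, h']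
  simp [ofPlane, genX, matE]

/-- Partial derivatives lower the homogeneity degree by one, and `2Y` is minus the Euler field. -/
lemma pderiv_leftInvariantField_genY (i : Fin 2) (u : smoothFun halfPlane) :
    pderiv halfPlane i ((2 : ℂ) • leftInvariantField genY u) =
      (2 : ℂ) • leftInvariantField genY (pderiv halfPlane i u) - pderiv halfPlane i u := by
  ext x
  have h := pderiv_coeff (genY.1 1 1) (genY.1 0 1) x
  have h' := pderiv_coeff' (genY.1 1 1) x
  fin_cases i
  all_goals
    simp only [Fin.zero_eta, Fin.mk_one, map_smul, leftInvariantField_apply, map_add, pderiv_mul,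
      pderiv_comm halfPlane 1 0, Subalgebra.coe_add, Subalgebra.coe_mul, Subalgebra.coe_smul,
      Subalgebra.coe_sub, Pi.add_apply, Pi.mul_apply, Pi.smul_apply, Pi.sub_apply, h, h']
    simp [ofPlane, genY, matH]
    ring

/-- The Euler field frozen at `x`: the constant coefficient field `x 0 ∂_p + x 1 ∂_q`. -/
def frozenEuler (U : Opens Plane) (x : Plane) : Module.End ℂ (smoothFun U) :=
  (x 0 : ℂ) • pderiv U 0 + (x 1 : ℂ) • pderiv U 1

lemma commute_pderiv_frozenEuler (U : Opens Plane) (i : Fin 2) (x : Plane) :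
    Commute (pderiv U i : Module.End ℂ (smoothFun U)) (frozenEuler U x) := by
  have h (j : Fin 2) : Commute (pderiv U i : Module.End ℂ (smoothFun U)) (pderiv U j) :=
    LinearMap.ext fun u => pderiv_comm U i j u
  exact ((h 0).smul_right _).add_right ((h 1).smul_right _)

/-- The frozen and the true Euler field agree only at `x`, so this can be applied only to the
outermost operator, just before evaluation at `x`. -/
lemma two_leftInvariantField_genY_apply_self (u : smoothFun halfPlane) (x : halfPlane) :
    ((2 : ℂ) • leftInvariantField genY u).1 x = -(frozenEuler halfPlane x u).1 x := by
  have := two_leftInvariantField_genY_apply u x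
  simpa [frozenEuler] using this

lemma frozenEuler_leftInvariantField_genY (x : Plane) (u : smoothFun halfPlane) :
    frozenEuler halfPlane x ((2 : ℂ) • leftInvariantField genY u) =
      (2 : ℂ) • leftInvariantField genY (frozenEuler halfPlane x u) -
        frozenEuler halfPlane x u := by
  -- `leftInvariantField` is only `ℝ`-linear by construction; this suffices since the frozen
  -- coefficients are real.
  have hs (c : ℝ) (w : smoothFun halfPlane) :
      leftInvariantField genY ((c : ℂ) • w) = (c : ℂ) • leftInvariantField genY w :=
    (leftInvariantField genY).map_smul c w
  simp only [frozenEuler, LinearMap.add_apply, LinearMap.smul_apply, map_add,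
    pderiv_leftInvariantField_genY, hs]
  module

/-- Iterates `T (2Y) = (2Y - 1) T` to `T^m (2Y) = (2Y - m) T^m`. It is needed both for `∂_p` and for
the frozen Euler field. -/
lemma pow_apply_leftInvariantField_genY {T : Module.End ℂ (smoothFun halfPlane)}
    (hT : ∀ u, T ((2 : ℂ) • leftInvariantField genY u) =
      (2 : ℂ) • leftInvariantField genY (T u) - T u) (m : ℕ) (u : smoothFun halfPlane) :
    (T ^ m) ((2 : ℂ) • leftInvariantField genY u) =
      (2 : ℂ) • leftInvariantField genY ((T ^ m) u) - (m : ℂ) • (T ^ m) u := by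
  induction m generalizing u with
  | zero => simp
  | succ m ih =>
    rw [pow_succ, Module.End.mul_apply, hT, map_sub, ih, Module.End.mul_apply]
    push_cast
    module

/-! ### The factors of the Rankin–Cohen element -/

/-- The action of `U(h₁)` on `C^∞(𝒪)` by left-invariant differential operators. -/
abbrev envAction : Uh1 →ₐ[ℝ] Module.End ℝ (smoothFun halfPlane) :=
  UniversalEnvelopingAlgebra.lift ℝ leftInvariantAction

lemma envAction_uX : envAction uX = leftInvariantField genX :=
  UniversalEnvelopingAlgebra.lift_ι_apply ℝ leftInvariantAction genX

lemma envAction_uY : envAction uY = leftInvariantField genY :=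
  UniversalEnvelopingAlgebra.lift_ι_apply ℝ leftInvariantAction genY

lemma envAction_uX_pow_apply (k : ℕ) (u : smoothFun halfPlane) (x : halfPlane) :
    (envAction (uX ^ k) u).1 x =
      (((x.1 1 : ℝ) : ℂ)⁻¹) ^ k *
        (((pderiv halfPlane 0 : Module.End ℂ (smoothFun halfPlane)) ^ k) u).1 x := by
  rw [map_pow, envAction_uX]
  induction k generalizing u with
  | zero => simp
  | succ k ih =>
    -- All derivatives pass the inner `X`, so that its coefficient `q⁻¹` is never differentiated.
    have hc (w : smoothFun halfPlane) :
        ((pderiv halfPlane 0 : Module.End ℂ (smoothFun halfPlane)) ^ k)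
            (leftInvariantField genX w) =
          leftInvariantField genX
            (((pderiv halfPlane 0 : Module.End ℂ (smoothFun halfPlane)) ^ k) w) := by
      clear ih
      induction k generalizing w with
      | zero => simp
      | succ k ih =>
        rw [pow_succ, Module.End.mul_apply, pderiv_leftInvariantField_genX, ih,
          Module.End.mul_apply]
    rw [pow_succ, Module.End.mul_apply, ih, hc, leftInvariantField_genX_apply,
      pow_succ' (pderiv halfPlane 0 : Module.End ℂ (smoothFun halfPlane)), Module.End.mul_apply]
    ring

lemma envAction_two_uY_add_natCast (r : ℕ) (u : smoothFun halfPlane) :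
    envAction (2 * uY + (r : Uh1)) u = (2 : ℂ) • leftInvariantField genY u + (r : ℂ) • u := by
  rw [map_add, map_mul, envAction_uY, map_natCast, map_ofNat]
  ext x
  simp [two_mul, Module.End.natCast_apply]

/-- The last factor `2Y + k + m` loses `k` on passing `∂_p^k` and `m` on passing `T^m`. What is left
is `2Y`, which at `x` is `-T`. -/
lemma pderiv_pow_rising_apply (k m : ℕ) (u : smoothFun halfPlane) (x : halfPlane) :
    (((pderiv halfPlane 0 : Module.End ℂ (smoothFun halfPlane)) ^ k)
        (envAction (rising (2 * uY + (k : Uh1)) m) u)).1 x =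
      (-1) ^ m * ((frozenEuler halfPlane x ^ m *
        (pderiv halfPlane 0 : Module.End ℂ (smoothFun halfPlane)) ^ k) u).1 x := by
  induction m generalizing u with
  | zero => simp [rising]
  | succ m ih =>
    -- Splitting off the last factor lets it act first on `u`, so the induction hypothesis applies
    -- to its image.
    have hr : rising (2 * uY + (k : Uh1)) (m + 1) =
        rising (2 * uY + (k : Uh1)) m * (2 * uY + ((k + m : ℕ) : Uh1)) := by
      simp [rising, ascPochhammer_succ_right, add_assoc]
    rw [hr, map_mul, Module.End.mul_apply, ih, envAction_two_uY_add_natCast, Module.End.mul_apply,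
      map_add, map_smul _ ((k + m : ℕ) : ℂ),
      pow_apply_leftInvariantField_genY (pderiv_leftInvariantField_genY 0), map_add, map_sub,
      map_smul _ ((k + m : ℕ) : ℂ), map_smul _ (k : ℂ),
      pow_apply_leftInvariantField_genY (frozenEuler_leftInvariantField_genY x)]
    set w := (frozenEuler halfPlane x ^ m)
      (((pderiv halfPlane 0 : Module.End ℂ (smoothFun halfPlane)) ^ k) u) with hw
    have e : (2 : ℂ) • leftInvariantField genY w - (m : ℂ) • w - (k : ℂ) • w +
        ((k + m : ℕ) : ℂ) • w = (2 : ℂ) • leftInvariantField genY w := by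
      push_cast
      module
    rw [e, two_leftInvariantField_genY_apply_self, pow_succ' (frozenEuler halfPlane x),
      Module.End.mul_apply, Module.End.mul_apply, ← hw]
    ring

lemma envAction_uX_pow_mul_rising_apply (k m : ℕ) (u : smoothFun halfPlane) (x : halfPlane) :
    (envAction (uX ^ k * rising (2 * uY + (k : Uh1)) m) u).1 x =
      (((x.1 1 : ℝ) : ℂ)⁻¹) ^ k * ((-1) ^ m * ((frozenEuler halfPlane x ^ m *
        (pderiv halfPlane 0 : Module.End ℂ (smoothFun halfPlane)) ^ k) u).1 x) := by
  rw [map_mul, Module.End.mul_apply, envAction_uX_pow_apply, pderiv_pow_rising_apply]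

/-! ### Comparison of the cochains -/

lemma rcBracket_apply (n : ℕ) (u v : smoothFun halfPlane) (x : halfPlane) :
    (rcBracket n u v).1 x = ∑ k ∈ Finset.range (n + 1),
      ((-1 : ℂ) ^ k / (k ! : ℂ) *
        (envAction (uX ^ k * rising (2 * uY + (k : Uh1)) (n - k)) u).1 x) *
      (1 / ((n - k) ! : ℂ) *
        (envAction (uX ^ (n - k) * rising (2 * uY + ((n - k : ℕ) : Uh1)) k) v).1 x) := by
  simp only [rcBracket, bidiffAction, rcElement, map_sum, TensorProduct.map_tmul,
    LinearMap.mul'_apply, map_smul, LinearMap.flip_apply, AlgHom.toLinearMap_apply]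
  have hev (s : Finset ℕ) (f : ℕ → smoothFun halfPlane) :
      (∑ k ∈ s, f k : smoothFun halfPlane).1 x = ∑ k ∈ s, (f k).1 x := by
    rw [← Finset.sum_apply]
    exact congrFun (map_sum (smoothFun halfPlane).val f s) x
  rw [hev]
  refine Finset.sum_congr rfl fun k _ => ?_
  -- Each element of `U(h₁)` stays whole under `envAction`, as in the statement.
  simp [-map_mul, -map_pow]
  ring

/-- The `s` terms cancel because `D₁ ∧ D₁ = 0`. -/
lemma smul_wedgeOperator {A : Type*} [CommRing A] [Algebra ℂ A] (D₁ D₂ : A →ₗ[ℂ] A) (s t : ℂ) :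
    t • wedgeOperator D₁ D₂ =
      (TensorProduct.map D₁ (s • D₁ + t • D₂) - TensorProduct.map (s • D₁ + t • D₂) D₁ :
        Module.End ℂ (A ⊗[ℂ] A)) := by
  simp only [wedgeOperator, TensorProduct.map_add_left, TensorProduct.map_add_right,
    TensorProduct.map_smul_left, TensorProduct.map_smul_right]
  module

/-- The binomial theorem for `D₁ ⊗ T` and `-(T ⊗ D₁)`, which commute because `D₁` and `T` do. -/
lemma wedgeOperator_pow_tmul {A : Type*} [CommRing A] [Algebra ℂ A] {D₁ D₂ T : Module.End ℂ A}
    {s t : ℂ} (hT : T = s • D₁ + t • D₂) (hc : Commute D₁ T) (n : ℕ) (u v : A) :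
    t ^ n • (wedgeOperator D₁ D₂ ^ n) (u ⊗ₜ[ℂ] v) =
      ∑ k ∈ Finset.range (n + 1), ((-1 : ℂ) ^ (n - k) * (n.choose k : ℂ)) •
        (((T ^ (n - k) * D₁ ^ k) u) ⊗ₜ[ℂ] ((T ^ k * D₁ ^ (n - k)) v)) := by
  have hcomm : Commute (TensorProduct.map D₁ T : Module.End ℂ (A ⊗[ℂ] A))
      ((-1 : ℂ) • (TensorProduct.map T D₁ : Module.End ℂ (A ⊗[ℂ] A))) := by
    apply Commute.smul_right
    change _ * _ = _ * _
    rw [← TensorProduct.map_mul, ← TensorProduct.map_mul, hc.eq]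
  have hW : t • wedgeOperator D₁ D₂ = (TensorProduct.map D₁ T : Module.End ℂ (A ⊗[ℂ] A)) +
      (-1 : ℂ) • (TensorProduct.map T D₁ : Module.End ℂ (A ⊗[ℂ] A)) := by
    rw [smul_wedgeOperator D₁ D₂ s t, hT]
    module
  rw [← LinearMap.smul_apply, ← smul_pow, hW, hcomm.add_pow, LinearMap.sum_apply]
  refine Finset.sum_congr rfl fun k _ => ?_
  rw [smul_pow, TensorProduct.map_pow, TensorProduct.map_pow, mul_smul_comm, smul_mul_assoc,
    ← TensorProduct.map_mul, (hc.pow_pow k (n - k)).eq, LinearMap.smul_apply,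
    ← Nat.cast_comm, ← nsmul_eq_mul, LinearMap.smul_apply, TensorProduct.map_tmul, mul_smul,
    Nat.cast_smul_eq_nsmul]

theorem rcBracket_eq_moyalCochain (n : ℕ) (u v : smoothFun halfPlane) :
    rcBracket n u v = moyalCochain halfPlane n u v := by
  ext x
  have hq : ((x.1 1 : ℝ) : ℂ) ≠ 0 := by exact_mod_cast ne_of_gt x.2
  let ev : smoothFun halfPlane →ₗ[ℂ] ℂ :=
    (LinearMap.proj x : (halfPlane → ℂ) →ₗ[ℂ] ℂ) ∘ₗ (smoothFun halfPlane).val.toLinearMap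
  have hW := congrArg (fun t => ev (LinearMap.mul' ℂ (smoothFun halfPlane) t))
    (wedgeOperator_pow_tmul (T := frozenEuler halfPlane x) rfl
      (commute_pderiv_frozenEuler halfPlane 0 x.1) n u v)
  simp only [map_sum, map_smul, LinearMap.mul'_apply] at hW
  have hM : (moyalCochain halfPlane n u v).1 x = (n ! : ℂ)⁻¹ *
      ev (LinearMap.mul' ℂ (smoothFun halfPlane)
        ((wedgeOperator (pderiv halfPlane 0) (pderiv halfPlane 1) ^ n) (u ⊗ₜ[ℂ] v))) := rfl
  -- The factor `q^n` turns the Moyal side into the binomial expansion, and cancels `q^{-k}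
  -- q^{-(n-k)}` on the other side.
  refine mul_left_cancel₀ (pow_ne_zero n hq) ?_
  rw [hM, mul_left_comm, ← smul_eq_mul (_ ^ n) (ev _), hW, rcBracket_apply, Finset.mul_sum,
    Finset.mul_sum]
  refine Finset.sum_congr rfl fun k hk => ?_
  have hkn : k ≤ n := Nat.lt_succ_iff.1 (Finset.mem_range.1 hk)
  obtain ⟨m, rfl⟩ := Nat.exists_eq_add_of_le hkn
  simp only [Nat.add_sub_cancel_left]
  rw [envAction_uX_pow_mul_rising_apply, envAction_uX_pow_mul_rising_apply,
    Nat.cast_add_choose ℂ, smul_eq_mul]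
  set a := (frozenEuler halfPlane x ^ m *
    (pderiv halfPlane 0 : Module.End ℂ (smoothFun halfPlane)) ^ k) u
  set b := (frozenEuler halfPlane x ^ k *
    (pderiv halfPlane 0 : Module.End ℂ (smoothFun halfPlane)) ^ m) v
  have hab : ev (a * b) = a.1 x * b.1 x := rfl
  have h1 : ((k + m)! : ℂ) ≠ 0 := by exact_mod_cast Nat.factorial_ne_zero _
  have h2 : (k ! : ℂ) ≠ 0 := by exact_mod_cast Nat.factorial_ne_zero _
  have h3 : (m ! : ℂ) ≠ 0 := by exact_mod_cast Nat.factorial_ne_zero _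
  have h4 : ((-1 : ℂ) ^ k) * (-1) ^ k = 1 := by rw [← mul_pow]; simp
  rw [hab, pow_add, inv_pow, inv_pow]
  field_simp
  -- The explicit sign `(-1)^k` cancels the one from the rising factorial acting on `v`; the
  -- `(-1)^m` from `u` is the binomial sign.
  linear_combination (a.1 x * b.1 x) * h4

/-! ### Restriction of the Moyal product -/

/-- The restriction map as a `ℂ`-algebra homomorphism. -/
def restrictAlgHom (U : Opens Plane) : smoothFun ⊤ →ₐ[ℂ] smoothFun U :=
  { restrict U with commutes' := fun _ => rfl }

lemma pderiv_restrictAlgHom (U : Opens Plane) (i : Fin 2) (f : smoothFun ⊤) :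
    pderiv U i (restrictAlgHom U f) = restrictAlgHom U (pderiv ⊤ i f) := by
  ext x
  -- The extensions differ off `U`, but `U` is open and a derivative sees only the germ.
  have he : zeroExt U (restrictAlgHom U f) =ᶠ[nhds x.1] zeroExt ⊤ f :=
    Filter.eventuallyEq_of_mem (U.isOpen.mem_nhds x.2) fun y hy => by
      rw [zeroExt_of_mem _ hy, zeroExt_of_mem _ (U := ⊤) (x := y) trivial]
      rfl
  change fderiv ℝ (zeroExt U (restrictAlgHom U f)) x.1 (Pi.single i 1) =
    fderiv ℝ (zeroExt ⊤ f) x.1 (Pi.single i 1)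
  rw [he.fderiv_eq]

/-- A map intertwining both pairs of operators also intertwines, on tensor squares, the wedge
operators and hence their powers. -/
lemma map_wedgeOperator_pow {A B : Type*} [CommRing A] [Algebra ℂ A] [CommRing B] [Algebra ℂ B]
    (r : A →ₗ[ℂ] B) {D₁ D₂ : A →ₗ[ℂ] A} {D₁' D₂' : B →ₗ[ℂ] B}
    (h₁ : D₁' ∘ₗ r = r ∘ₗ D₁) (h₂ : D₂' ∘ₗ r = r ∘ₗ D₂) (n : ℕ) (t : A ⊗[ℂ] A) :
    (wedgeOperator D₁' D₂' ^ n) (TensorProduct.map r r t) =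
      TensorProduct.map r r ((wedgeOperator D₁ D₂ ^ n) t) := by
  have h (s : A ⊗[ℂ] A) : wedgeOperator D₁' D₂' (TensorProduct.map r r s) =
      TensorProduct.map r r (wedgeOperator D₁ D₂ s) := by
    rw [wedgeOperator, wedgeOperator, LinearMap.sub_apply, LinearMap.sub_apply, map_sub]
    simp only [← LinearMap.comp_apply, ← TensorProduct.map_comp, h₁, h₂]
  induction n generalizing t with
  | zero => rfl
  | succ n ih => rw [pow_succ, pow_succ, Module.End.mul_apply, Module.End.mul_apply, h, ih]

lemma moyalCochain_restrict (U : Opens Plane) (n : ℕ) (f g : smoothFun ⊤) :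
    moyalCochain U n (restrict U f) (restrict U g) = restrict U (moyalCochain ⊤ n f g) := by
  have hmul (t : smoothFun ⊤ ⊗[ℂ] smoothFun ⊤) :
      LinearMap.mul' ℂ (smoothFun U) (TensorProduct.map (restrictAlgHom U).toLinearMap
        (restrictAlgHom U).toLinearMap t) =
      restrictAlgHom U (LinearMap.mul' ℂ (smoothFun ⊤) t) := by
    induction t with
    | zero => simp
    | tmul a b => simp
    | add a b ha hb => simp only [map_add, ha, hb]
  have hd (i : Fin 2) : pderiv U i ∘ₗ (restrictAlgHom U).toLinearMap =
      (restrictAlgHom U).toLinearMap ∘ₗ pderiv ⊤ i :=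
    LinearMap.ext (pderiv_restrictAlgHom U i)
  change moyalCochain U n (restrictAlgHom U f) (restrictAlgHom U g) =
    restrictAlgHom U (moyalCochain ⊤ n f g)
  simp only [moyalCochain, map_smul]
  rw [← hmul, ← map_wedgeOperator_pow _ (hd 0) (hd 1)]
  rfl

lemma moyalProduct_restrict (U : Opens Plane) (c : ℂ) (f g : PowerSeries (smoothFun ⊤)) :
    moyalProduct U c (PowerSeries.map (restrict U) f) (PowerSeries.map (restrict U) g) =
      PowerSeries.map (restrict U) (moyalProduct ⊤ c f g) := by
  have hs (w : smoothFun ⊤) (z : ℂ) : restrict U (z • w) = z • restrict U w :=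
    map_smul (restrictAlgHom U) z w
  ext1 N
  simp only [moyalProduct, formalProduct, PowerSeries.coeff_map, PowerSeries.coeff_mk, map_sum,
    moyalCochain_restrict, hs]

theorem rcProduct_eq_moyalProduct (c : ℂ) (a b : PowerSeries (smoothFun halfPlane)) :
    rcProduct c a b = moyalProduct halfPlane c a b := by
  simp only [rcProduct, moyalProduct, rcBracket_eq_moyalCochain]

end

end RankinCohen

theorem proposition3p3 (c : ℂ) :
    (∀ a b : PowerSeries (RankinCohen.smoothFun RankinCohen.halfPlane),
      RankinCohen.rcProduct c a b = RankinCohen.moyalProduct RankinCohen.halfPlane c a b) ∧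
    (∀ f g : PowerSeries (RankinCohen.smoothFun ⊤),
      RankinCohen.rcProduct c
          (PowerSeries.map (RankinCohen.restrict RankinCohen.halfPlane) f)
          (PowerSeries.map (RankinCohen.restrict RankinCohen.halfPlane) g) =
        PowerSeries.map (RankinCohen.restrict RankinCohen.halfPlane)
          (RankinCohen.moyalProduct ⊤ c f g)) :=
  ⟨RankinCohen.rcProduct_eq_moyalProduct c, fun f g => by
    rw [RankinCohen.rcProduct_eq_moyalProduct, RankinCohen.moyalProduct_restrict]⟩
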